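/- By a \emph{polygon} we mean a two-dimensional convex lattice polygon, i.e. the convex hull in $\mathbb{R}^2$ of a finite set of points of $\mathbb{Z}^2$, not all on one line. For a polygon $Q$, the \emph{interior polygon} $Q_{\mathrm{int}}$ is the convex hull of the lattice points lying in the topological interior of $Q$ (it may be empty, a point or a segment). Two lattice points are \emph{visible} to one another if the segment joining them contains no lattice points other than these two. A polygon $P$ is a \emph{panoptigon} if there is a point $p\in P\cap\mathbb{Z}^2$ from which every point of $P\cap\mathbb{Z}^2$ is visible. A polygon $P$ is a \emph{diploptigon} if it is not a panoptigon, but there are distinct points $p,q\in P\cap\mathbb{Z}^2$ such that every lattice point of $P$ other than $q$ is visible from $p$, every lattice point of $P$ other than $p$ is visible from $q$, and no two of these lines of sight (the segments from $p$, respectively from $q$, to the lattice points of $P$ other than $p$ and $q$) cross, i.e. no two of them have a common point in their relative interiors. \textbf{Proposition.} If $Q$ is a convex lattice polygon, then $Q_{\mathrm{int}}$ is not a diploptigon. -/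

import Mathlib

/-- The lattice `ℤ²`, as a subset of the plane `ℝ²`. -/
def latticePoints : Set (ℝ × ℝ) :=
  {x | ∃ a b : ℤ, x = ((a : ℝ), (b : ℝ))}

/-- A convex lattice polygon: the convex hull of finitely many lattice points,
required to be two-dimensional. -/
def IsLatticePolygon (P : Set (ℝ × ℝ)) : Prop :=
  (∃ V : Set (ℝ × ℝ), V.Finite ∧ V ⊆ latticePoints ∧ P = convexHull ℝ V) ∧
    (interior P).Nonempty

/-- The interior polygon of `P`: the convex hull of the lattice points in the interior of `P`.
It may be empty, a point or a segment. -/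
def interiorPolygon (P : Set (ℝ × ℝ)) : Set (ℝ × ℝ) :=
  convexHull ℝ (interior P ∩ latticePoints)

/-- `p` and `q` are visible to one another: the closed segment from `p` to `q` contains no
lattice points other than `p` and `q`. -/
def LatticeVisible (p q : ℝ × ℝ) : Prop :=
  ∀ x ∈ segment ℝ p q, x ∈ latticePoints → x = p ∨ x = q

/-- A panoptigon: a lattice polygon all of whose lattice points are visible from one of them. -/
def IsPanoptigon (P : Set (ℝ × ℝ)) : Prop :=
  IsLatticePolygon P ∧
    ∃ p ∈ P ∩ latticePoints, ∀ r ∈ P ∩ latticePoints, LatticeVisible p r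

/-- The relative interiors of the lines of sight for the pair `p`, `q`: the segments from `p` to
the lattice points of `P` besides `q`, and from `q` to the lattice points of `P` besides `p`
(the degenerate segments from `p` to `p` and from `q` to `q` are left out). -/
def openSightLines (P : Set (ℝ × ℝ)) (p q : ℝ × ℝ) : Set (Set (ℝ × ℝ)) :=
  {S | ∃ r ∈ P ∩ latticePoints, r ≠ p ∧ r ≠ q ∧
    (S = openSegment ℝ p r ∨ S = openSegment ℝ q r)}

/-- `p`, `q` is a pair of distinct lattice points of `P` such that every lattice point of `P`
besides `q` is visible from `p`, every one besides `p` is visible from `q`, and no two of these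
lines of sight cross, that is, meet at a point that is an endpoint of neither.
(Given visibility, an endpoint of one line of sight is never in the relative interior of
another, so this is the same as meeting only at common endpoints.) -/
def IsDiploptigonPair (P : Set (ℝ × ℝ)) (p q : ℝ × ℝ) : Prop :=
  p ∈ P ∩ latticePoints ∧ q ∈ P ∩ latticePoints ∧ p ≠ q ∧
    (∀ r ∈ P ∩ latticePoints, r ≠ q → LatticeVisible p r) ∧
    (∀ r ∈ P ∩ latticePoints, r ≠ p → LatticeVisible q r) ∧
    (openSightLines P p q).Pairwise Disjoint

/-- A diploptigon: a lattice polygon that is not a panoptigon but has a pair of diploptigon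
points. -/
def IsDiploptigon (P : Set (ℝ × ℝ)) : Prop :=
  IsLatticePolygon P ∧ ¬ IsPanoptigon P ∧ ∃ p q : ℝ × ℝ, IsDiploptigonPair P p q

/-! Since the interior polygon is not a panoptigon, `p` and `q` cannot see each other. The sight
conditions then put them at lattice distance two, so unimodular coordinates give `p = (-1, 0)`, `q =
(1, 0)` (`IsDiploptigonPair.exists_frame`). Non-crossing leaves at most one interior lattice point
at each height `±1` (`sightLines_cross`), and convexity forces those above the axis onto one ray
from the origin, likewise below (`exists_upper_ray`). After a shear and reflections the rays end at
`(0, n)` and `(n' * e, -n')` with `n ≥ 1` and `e ≥ 0`.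

A lattice point of `Q` lies at most one lattice step beyond an edge of the interior polygon
(`beyond_le_one`). But `(-1, 0)` is interior to `Q`, so some lattice point of `Q` lies strictly to
its left; the bounds for the two edges at `(-1, 0)` give `n + n' ≤ 2` (`false_of_rays`). So few
points remain that `(0, 1)` or `(0, 0)` sees them all, contradicting the failure of the panoptigon
property. -/

/-- The combinatorial data of a diploptigon pair `(-1, 0)`, `(1, 0)` inside a lattice polygon, in
integer coordinates: `V` are the lattice points of the polygon, `J` those in its interior. -/
structure SightConfig (J V : ℤ → ℤ → Prop) : Prop where
  left : J (-1) 0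
  mid : J 0 0
  right : J 1 0
  axis : ∀ i, J i 0 → -1 ≤ i ∧ i ≤ 1
  unique : ∀ δ a b : ℤ, δ = 1 ∨ δ = -1 → J a δ → J b δ → a = b
  sub : ∀ i j, J i j → V i j
  -- Weights `α`, `β` on interior points and `1` on a polygon point, denominators cleared: positive
  -- weight on the interior keeps the average interior.
  combo : ∀ a₁ a₂ b₁ b₂ v₁ v₂ w₁ w₂ α β : ℤ, J a₁ a₂ → J b₁ b₂ → V v₁ v₂ → 0 ≤ α → 0 ≤ β →
    1 ≤ α + β → (α + β + 1) * w₁ = α * a₁ + β * b₁ + v₁ →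
    (α + β + 1) * w₂ = α * a₂ + β * b₂ + v₂ → J w₁ w₂
  exceed : ∀ A B i j : ℤ, (A ≠ 0 ∨ B ≠ 0) → J i j → ∃ v₁ v₂, V v₁ v₂ ∧ A * i + B * j < A * v₁ + B * v₂
  hidden : ∀ i j, J i j → ∃ k l, J k l ∧ (k ≠ i ∨ l ≠ j) ∧ ¬ IsCoprime (k - i) (l - j)
  bounded : ∃ N : ℕ, ∀ i j, J i j → |j| ≤ N

/-! ### Nonexistence of configurations -/

namespace SightConfig

variable {J V : ℤ → ℤ → Prop}

/-- Configurations are preserved by the unimodular maps that preserve the axis. -/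
theorem transform (h : SightConfig J V) {ε δ : ℤ} (hε : ε = 1 ∨ ε = -1) (hδ : δ = 1 ∨ δ = -1)
    (s : ℤ) : SightConfig (fun i j => J (ε * i + s * j) (δ * j))
      (fun i j => V (ε * i + s * j) (δ * j)) := by
  have hε2 : ε * ε = 1 := by rcases hε with rfl | rfl <;> norm_num
  have hδ2 : δ * δ = 1 := by rcases hδ with rfl | rfl <;> norm_num
  refine ⟨?_, ?_, ?_, ?_, ?_, ?_, ?_, ?_, ?_, ?_⟩
  · rcases hε with rfl | rfl <;> simp [h.left, h.right]
  · simp [h.mid]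
  · rcases hε with rfl | rfl <;> simp [h.left, h.right]
  · intro i hi
    simp only [mul_zero, add_zero] at hi
    have := h.axis _ hi
    rcases hε with rfl | rfl <;> omega
  · intro d a b hd ha hb
    have h1 : δ * d = 1 ∨ δ * d = -1 := by
      rcases hδ with rfl | rfl <;> rcases hd with rfl | rfl <;> norm_num
    have := h.unique _ _ _ h1 ha hb
    rcases hε with rfl | rfl <;> omega
  · exact fun i j hj => h.sub _ _ hj
  · intro a₁ a₂ b₁ b₂ v₁ v₂ w₁ w₂ α β ha hb hv hα hβ hαβ h1 h2
    refine h.combo _ _ _ _ _ _ _ _ α β ha hb hv hα hβ hαβ ?_ ?_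
    · linear_combination ε * h1 + s * h2
    · linear_combination δ * h2
  · intro A B i j hAB hij
    obtain ⟨v₁, v₂, hv, hlt⟩ := h.exceed (A * ε) ((B - A * ε * s) * δ) _ _ (by
      by_contra! hc
      have hA : A = 0 := by linear_combination ε * hc.1 - A * hε2
      have hB : B = 0 := by
        subst hA
        linear_combination δ * hc.2 - B * hδ2
      rcases hAB with h | h <;> contradiction) hij
    refine ⟨ε * (v₁ - s * (δ * v₂)), δ * v₂, ?_, ?_⟩
    · convert hv using 1
      · linear_combination (v₁ - s * δ * v₂) * hε2
      · linear_combination v₂ * hδ2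
    · refine lt_of_eq_of_lt ?_ (hlt.trans_eq ?_)
      · linear_combination (-A * i) * hε2 + (-(B - A * ε * s) * j) * hδ2
      · ring
  · intro i j hij
    obtain ⟨k, l, hkl, hne, hco⟩ := h.hidden _ _ hij
    have e1 : ε * (ε * (k - s * (δ * l))) + s * (δ * l) = k := by
      linear_combination (k - s * δ * l) * hε2
    have e2 : δ * (δ * l) = l := by linear_combination l * hδ2
    refine ⟨ε * (k - s * (δ * l)), δ * l, ?_, ?_, ?_⟩
    · simpa only [e1, e2] using hkl
    · by_contra! hc
      rw [← hc.1, ← hc.2, e1, e2] at hne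
      simp at hne
    · rintro ⟨a, b, hab⟩
      refine hco ⟨a * ε, (b - a * ε * s) * δ, ?_⟩
      linear_combination hab + (-a * i) * hε2 + (-(b - a * ε * s) * j) * hδ2
  · obtain ⟨N, hN⟩ := h.bounded
    refine ⟨N, fun i j hij => ?_⟩
    have := hN _ _ hij
    rcases hδ with rfl | rfl <;> simpa using this

/-- Points of positive height project to the point of height one: `j ∣ i`. -/
theorem exists_height_one (h : SightConfig J V) {i j : ℤ} (hj : 0 < j) (hij : J i j) :
    ∃ c, J c 1 ∧ i = j * c := by
  rcases eq_or_lt_of_le (show 1 ≤ j by omega) with rfl | hj1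
  · exact ⟨i, hij, by ring⟩
  have hm := Int.emod_add_mul_ediv i j
  have hm0 := Int.emod_nonneg i hj.ne'
  have hm1 := Int.emod_lt_of_pos i hj
  -- The triangle with apex `(i, j)` over the axis segment contains both roundings of `i / j` at
  -- height one, so uniqueness rules out a nonzero remainder.
  have lo : J (i / j) 1 := by
    refine h.combo (-1) 0 0 0 i j _ _ (i % j) (j - 1 - i % j) h.left h.mid (h.sub _ _ hij) hm0
      (by omega) (by omega) ?_ ?_
    · linear_combination hm
    · ring
  rcases eq_or_lt_of_le hm0 with h0 | h0
  · exact ⟨i / j, lo, by linear_combination -hm - h0⟩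
  have hi : J (i / j + 1) 1 := by
    refine h.combo 1 0 0 0 i j _ _ (j - i % j) (i % j - 1) h.right h.mid (h.sub _ _ hij)
      (by omega) (by omega) (by omega) ?_ ?_
    · linear_combination hm
    · ring
  have := h.unique 1 _ _ (Or.inl rfl) lo hi
  omega

/-- There is a direction `e` that contains all points of positive height, and a largest height. -/
theorem exists_upper_ray (h : SightConfig J V) : ∃ e n : ℤ, 0 ≤ n ∧ J (n * e) n ∧
    ((∃ i j, J i j ∧ 0 < j) → J e 1) ∧ ∀ i j, J i j → 0 < j → i = j * e ∧ j ≤ n := by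
  by_cases hex : ∃ i j, J i j ∧ 0 < j
  · obtain ⟨i, j, hij, hj⟩ := hex
    obtain ⟨e, he, -⟩ := h.exists_height_one hj hij
    have key : ∀ i j, J i j → 0 < j → i = j * e := by
      intro i j hij hj
      obtain ⟨c, hc, rfl⟩ := h.exists_height_one hj hij
      rw [h.unique 1 _ _ (Or.inl rfl) hc he]
    obtain ⟨N, hN⟩ := h.bounded
    obtain ⟨n, hn, hmax⟩ := Int.exists_greatest_of_bdd (P := fun n => J (n * e) n)
      ⟨N, fun z hz => (le_abs_self z).trans (hN _ _ hz)⟩ ⟨1, by simpa using he⟩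
    have h1n : 1 ≤ n := hmax 1 (by simpa using he)
    refine ⟨e, n, by omega, hn, fun _ => he, fun i j hij hj => ?_⟩
    obtain rfl := key i j hij hj
    exact ⟨rfl, hmax _ hij⟩
  · refine ⟨0, 0, le_rfl, by simpa using h.mid, fun h => absurd h hex, fun i j hij hj => ?_⟩
    exact absurd ⟨i, j, hij, hj⟩ hex

/-- No lattice point of the polygon lies two or more steps beyond a primitive segment that bounds
the interior lattice points. -/
theorem beyond_le_one (h : SightConfig J V) {a₁ a₂ u₁ u₂ x y : ℤ} (hxy : x * u₁ + y * u₂ = 1)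
    (ha : J a₁ a₂) (hb : J (a₁ + u₁) (a₂ + u₂))
    (hle : ∀ i j, J i j → u₁ * (j - a₂) - u₂ * (i - a₁) ≤ 0) {v₁ v₂ : ℤ} (hv : V v₁ v₂) :
    u₁ * (v₂ - a₂) - u₂ * (v₁ - a₁) ≤ 1 := by
  by_contra! hk
  set k := u₁ * (v₂ - a₂) - u₂ * (v₁ - a₁) with hkdef
  set s := x * (v₁ - a₁) + y * (v₂ - a₂) with hs
  have hm := Int.emod_add_mul_ediv (-s) k
  have hm0 := Int.emod_nonneg (-s) (show k ≠ 0 by omega)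
  have hm1 := Int.emod_lt_of_pos (-s) (show 0 < k by omega)
  set r := -s % k
  set t := -s / k
  -- At distance one the triangle on the segment with apex `v` offers `k` consecutive multiples of
  -- `1 / k` as positions; the residue `r` picks the integral one. It is interior to `Q` but
  -- violates `hle`.
  have hw : J (a₁ - t * u₁ - y) (a₂ - t * u₂ + x) := by
    refine h.combo (a₁ + u₁) (a₂ + u₂) a₁ a₂ v₁ v₂ _ _ r (k - 1 - r) hb ha hv hm0 (by omega)
      (by omega) ?_ ?_
    · linear_combination (-u₁) * hm - y * hkdef - u₁ * hs + (v₁ - a₁) * hxy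
    · linear_combination (-u₂) * hm + x * hkdef - u₂ * hs + (v₂ - a₂) * hxy
  have := hle _ _ hw
  have : (1 : ℤ) ≤ 0 := by linarith
  omega

/-- A configuration whose points of positive height lie on the line `i = 0` and whose points of
negative height lie in direction `(e, -1)` with `0 ≤ e` does not exist. -/
theorem false_of_rays (h : SightConfig J V) {e n n' : ℤ} (he : 0 ≤ e) (hn : 1 ≤ n) (hn' : 0 ≤ n')
    (h1 : J 0 1) (htop : J 0 n) (hbot : J (n' * e) (-n'))
    (hup : ∀ i j, J i j → 0 < j → i = 0 ∧ j ≤ n)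
    (hdown : ∀ i j, J i j → j < 0 → i = -j * e ∧ -j ≤ n') : False := by
  obtain ⟨v₁, v₂, hv, hlt⟩ := h.exceed (-1) 0 (-1) 0 (by norm_num) h.left
  have f1 : 1 * (v₂ - 0) - n * (v₁ - -1) ≤ 1 := by
    refine h.beyond_le_one (x := 1) (y := 0) (by ring) h.left (by simpa using htop) ?_ hv
    intro i j hij
    rcases lt_trichotomy j 0 with hj | rfl | hj
    · obtain ⟨rfl, hj'⟩ := hdown i j hij hj
      nlinarith [mul_nonneg (show 0 ≤ -j by omega) he]
    · nlinarith [h.axis i hij]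
    · obtain ⟨rfl, hj'⟩ := hup i j hij hj
      linarith
  -- reflect to put the polygon on the correct side of the lower edge
  have hr := h.transform (ε := 1) (δ := -1) (Or.inl rfl) (Or.inr rfl) 0
  have f2 : (n' * e + 1) * (-v₂ - 0) - n' * (v₁ - -1) ≤ 1 := by
    refine hr.beyond_le_one (x := 1) (y := -e) (by ring) hr.left (by simpa using hbot) ?_
      (by simpa using hv)
    intro i j hij
    simp only [one_mul, zero_mul, add_zero, neg_one_mul] at hij
    rcases lt_trichotomy j 0 with hj | rfl | hj
    · obtain ⟨rfl, hj'⟩ := hup _ _ hij (by omega)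
      nlinarith [mul_nonneg hn' he]
    · nlinarith [h.axis i (by simpa using hij)]
    · obtain ⟨rfl, hj'⟩ := hdown _ _ hij (by omega)
      nlinarith
  -- With `m = -v₁ - 1 ≥ 1`, `f1` gives `-v₂ ≥ n * m - 1 ≥ n - 1`, and `f2` then yields `(n - 1) +
  -- n' ≤ 1`.
  have hsum : n + n' ≤ 2 := by
    have hm : 1 ≤ -v₁ - 1 := by omega
    have h3 : n - 1 ≤ -v₂ := by nlinarith
    have h4 := mul_le_mul_of_nonneg_left h3 (mul_nonneg hn' he)
    have h5 : 0 ≤ n' * e * (n - 1) := by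
      have := mul_nonneg hn' he
      exact mul_nonneg this (by omega)
    nlinarith
  have cop1 : ∀ a b : ℤ, (b = 1 ∨ b = -1) → IsCoprime a b := by
    rintro a b (rfl | rfl)
    · exact isCoprime_one_right
    · exact isCoprime_one_right.neg_right
  -- If `n' = 0`, all heights are between 0 and 2 and `(0, 1)` sees everything; otherwise `n = n' =
  -- 1` and `(0, 0)` does.
  rcases eq_or_lt_of_le hn' with rfl | hpos
  · obtain ⟨k, l, hkl, hne, hco⟩ := h.hidden 0 1 h1
    refine hco ?_
    rcases lt_trichotomy l 0 with hl | rfl | hl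
    · have := hdown _ _ hkl hl
      omega
    · exact cop1 _ _ (by omega)
    · have := hup _ _ hkl hl
      exact cop1 _ _ (by omega)
  · obtain ⟨k, l, hkl, hne, hco⟩ := h.hidden 0 0 h.mid
    refine hco ?_
    rcases lt_trichotomy l 0 with hl | rfl | hl
    · have := hdown _ _ hkl hl
      exact cop1 _ _ (by omega)
    · have := h.axis _ hkl
      exact (cop1 _ _ (by omega)).symm
    · have := hup _ _ hkl hl
      exact cop1 _ _ (by omega)

theorem false_of_height_one (h : SightConfig J V) (h1 : J 0 1) : False := by
  have hr := h.transform (ε := 1) (δ := -1) (Or.inl rfl) (Or.inr rfl) 0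
  obtain ⟨e, n', hn', hbot, -, hdown⟩ := hr.exists_upper_ray
  obtain ⟨e₀, n, -, htop, hone, hup⟩ := h.exists_upper_ray
  obtain rfl : e₀ = 0 := h.unique 1 _ _ (Or.inl rfl) (hone ⟨0, 1, h1, one_pos⟩) h1
  simp only [one_mul, zero_mul, add_zero, neg_one_mul, mul_zero] at hbot hdown htop hup
  have hn : 1 ≤ n := (hup 0 1 h1 one_pos).2
  have hdown' : ∀ i j, J i j → j < 0 → i = -j * e ∧ -j ≤ n' := fun i j hij hj =>
    hdown i (-j) (by simpa using hij) (by omega)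
  rcases le_total 0 e with he | he
  · exact h.false_of_rays he hn hn' h1 htop hbot hup hdown'
  · have hf := h.transform (ε := -1) (δ := 1) (Or.inr rfl) (Or.inl rfl) 0
    refine hf.false_of_rays (e := -e) (n := n) (n' := n') (by omega) hn hn' ?_ ?_ ?_ ?_ ?_
    · simpa using h1
    · simpa using htop
    · simpa using hbot
    · intro i j hij hj
      have := hup _ _ hij (by omega)
      omega
    · intro i j hij hj
      obtain ⟨h2, h3⟩ := hdown' _ _ hij (by omega)
      exact ⟨by linear_combination -h2, by linarith⟩

theorem false_of_pos (h : SightConfig J V) {i j : ℤ} (hij : J i j) (hj : 0 < j) : False := by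
  obtain ⟨c, hc, -⟩ := h.exists_height_one hj hij
  exact (h.transform (ε := 1) (δ := 1) (Or.inl rfl) (Or.inl rfl) c).false_of_height_one
    (by simpa using hc)

/-- There are no such configurations. -/
theorem not_exists (h : SightConfig J V) : False := by
  obtain ⟨k, l, hkl, hne, hco⟩ := h.hidden 0 0 h.mid
  rcases lt_trichotomy l 0 with hl | rfl | hl
  · exact (h.transform (ε := 1) (δ := -1) (Or.inl rfl) (Or.inr rfl) 0).false_of_pos (i := k)
      (j := -l) (by simpa using hkl) (by omega)
  · have := h.axis _ hkl
    obtain rfl | rfl : k = 1 ∨ k = -1 := by omega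
    · exact hco isCoprime_one_left
    · exact hco isCoprime_one_left.neg_left
  · exact h.false_of_pos hkl hl

end SightConfig

/-! ### Visibility and lattice polygons -/

theorem mem_latticePoints (a b : ℤ) : ((a : ℝ), (b : ℝ)) ∈ latticePoints := ⟨a, b, rfl⟩

/-- Bézout coefficients express the parameter of a lattice point on the segment as an integer, hence
0 or 1. -/
theorem latticeVisible_of_isCoprime {a b c d : ℤ} (h : IsCoprime (c - a) (d - b)) :
    LatticeVisible ((a : ℝ), (b : ℝ)) ((c : ℝ), (d : ℝ)) := by
  rintro _ ⟨s, t, hs, ht, hst, rfl⟩ ⟨i, j, hij⟩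
  obtain ⟨x, y, hxy⟩ := h
  have h1 : s * a + t * c = i := by simpa using congrArg Prod.fst hij
  have h2 : s * b + t * d = j := by simpa using congrArg Prod.snd hij
  have hxy' : (x : ℝ) * (c - a) + y * (d - b) = 1 := by exact_mod_cast hxy
  have h3 : t = ((x * (i - a) + y * (j - b) : ℤ) : ℝ) := by
    push_cast
    linear_combination -t * hxy' + x * h1 + y * h2 - (x * a + y * b) * hst
  obtain ⟨n, hn⟩ : ∃ n : ℤ, t = n := ⟨_, h3⟩
  have hn0 : 0 ≤ n := by exact_mod_cast hn ▸ ht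
  have hn1 : n ≤ 1 := by
    have : (n : ℝ) ≤ 1 := by linarith
    exact_mod_cast this
  obtain rfl | rfl : n = 0 ∨ n = 1 := by omega
  · left
    obtain rfl : t = 0 := by simpa using hn
    obtain rfl : s = 1 := by linarith
    simp
  · right
    obtain rfl : t = 1 := by simpa using hn
    obtain rfl : s = 0 := by linarith
    simp

theorem interiorPolygon_subset {Q : Set (ℝ × ℝ)} (hQ : Convex ℝ Q) :
    interiorPolygon Q ⊆ interior Q :=
  convexHull_min Set.inter_subset_left hQ.interior

theorem interior_inter_subset (Q : Set (ℝ × ℝ)) :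
    interior Q ∩ latticePoints ⊆ interiorPolygon Q :=
  subset_convexHull ℝ _

theorem IsLatticePolygon.convex {Q : Set (ℝ × ℝ)} (hQ : IsLatticePolygon Q) : Convex ℝ Q := by
  obtain ⟨⟨V, -, -, rfl⟩, -⟩ := hQ
  exact convex_convexHull ℝ V

theorem IsLatticePolygon.isBounded {Q : Set (ℝ × ℝ)} (hQ : IsLatticePolygon Q) :
    Bornology.IsBounded Q := by
  obtain ⟨⟨V, hV, -, rfl⟩, -⟩ := hQ
  exact isBounded_convexHull.2 hV.isBounded

/-- No nonzero functional attains its maximum over the lattice points of a polygon at an interior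
point. -/
theorem IsLatticePolygon.exists_lt {Q : Set (ℝ × ℝ)} (hQ : IsLatticePolygon Q) {A B : ℝ}
    (hAB : A ≠ 0 ∨ B ≠ 0) {x : ℝ × ℝ} (hx : x ∈ interior Q) :
    ∃ c d : ℤ, ((c : ℝ), (d : ℝ)) ∈ Q ∧ A * x.1 + B * x.2 < A * c + B * d := by
  by_contra! hc
  have hsub : Q ⊆ {y : ℝ × ℝ | A * y.1 + B * y.2 ≤ A * x.1 + B * x.2} := by
    obtain ⟨⟨V, -, hVl, rfl⟩, -⟩ := hQ
    refine convexHull_min ?_ ?_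
    · intro y hy
      obtain ⟨c, d, rfl⟩ := hVl hy
      exact hc c d (subset_convexHull ℝ V hy)
    · refine convex_halfSpace_le ⟨fun y z => ?_, fun s y => ?_⟩ _
      · simp; ring
      · simp; ring
  -- A small push of `x` along `(A, B)` stays in `Q` but increases the functional.
  have hcont : Filter.Tendsto (fun t : ℝ => (x.1 + t * A, x.2 + t * B)) (nhds 0) (nhds x) := by
    have : Continuous (fun t : ℝ => (x.1 + t * A, x.2 + t * B)) := by fun_prop
    simpa using this.tendsto 0
  have hev := hcont.eventually (mem_interior_iff_mem_nhds.1 hx)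
  obtain ⟨t, ht, ht0⟩ := ((hev.filter_mono nhdsWithin_le_nhds).and
    (self_mem_nhdsWithin (s := Set.Ioi (0 : ℝ)))).exists
  have h1 : A * (x.1 + t * A) + B * (x.2 + t * B) ≤ A * x.1 + B * x.2 := hsub ht
  have h2 : 0 < A * A + B * B := by
    rcases hAB with h | h
    · nlinarith [mul_self_pos.2 h, mul_self_nonneg B]
    · nlinarith [mul_self_pos.2 h, mul_self_nonneg A]
  have h3 : 0 < t * (A * A + B * B) := mul_pos ht0 h2
  linarith

/-! ### Coordinates adapted to the pair -/

/-- The point with integer coordinates `(i, j)` in the frame with origin `(m₁, m₂)` and basis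
`(c, d)`, `(-y, x)`. -/
def frame (m₁ m₂ c d x y i j : ℤ) : ℝ × ℝ :=
  (((m₁ + i * c - j * y : ℤ) : ℝ), ((m₂ + i * d + j * x : ℤ) : ℝ))

/-- The end points of a diploptigon pair that are not mutually visible are at lattice distance
two. -/
theorem IsDiploptigonPair.exists_frame {P : Set (ℝ × ℝ)} (hP : Convex ℝ P) {p q : ℝ × ℝ}
    (h : IsDiploptigonPair P p q) (hvis : ¬ LatticeVisible p q) :
    ∃ m₁ m₂ c d x y : ℤ, x * c + y * d = 1 ∧ p = frame m₁ m₂ c d x y (-1) 0 ∧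
      q = frame m₁ m₂ c d x y 1 0 := by
  obtain ⟨⟨hpP, p₁, p₂, rfl⟩, ⟨hqP, q₁, q₂, rfl⟩, hpq, -, hq, -⟩ := h
  have hne : q₁ - p₁ ≠ 0 ∨ q₂ - p₂ ≠ 0 := by
    by_contra! hc
    exact hpq (by rw [sub_eq_zero.1 hc.1, sub_eq_zero.1 hc.2])
  have hg : 0 < Int.gcd (q₁ - p₁) (q₂ - p₂) := Int.gcd_pos_iff.2 hne
  obtain ⟨c, d, hcop, h1, h2⟩ := Int.exists_gcd_one hg
  set g := Int.gcd (q₁ - p₁) (q₂ - p₂)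
  have hco : IsCoprime c d := Int.isCoprime_iff_gcd_eq_one.2 hcop
  obtain ⟨x, y, hxy⟩ := hco
  have hg1 : g ≠ 1 := by
    intro hg1
    refine hvis (latticeVisible_of_isCoprime ?_)
    rw [h1, h2, hg1]
    exact ⟨x, y, by push_cast; linear_combination hxy⟩
  have hg2 : 2 ≤ g := by omega
  have hgR : (2 : ℝ) ≤ g := by exact_mod_cast hg2
  have hgpos : (0 : ℝ) < g := by linarith
  have h1R : (q₁ : ℝ) = p₁ + c * g := by
    have : q₁ = p₁ + c * g := by linarith
    exact_mod_cast this
  have h2R : (q₂ : ℝ) = p₂ + d * g := by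
    have : q₂ = p₂ + d * g := by linarith
    exact_mod_cast this
  have hm : (((p₁ + c : ℤ) : ℝ), ((p₂ + d : ℤ) : ℝ)) ∈ P := by
    refine hP.segment_subset hpP hqP ⟨1 - 1 / g, 1 / g, ?_, by positivity, by ring, ?_⟩
    · rw [sub_nonneg, div_le_one hgpos]; linarith
    · ext
      · simp [h1R]; field_simp; ring
      · simp [h2R]; field_simp; ring
  have hcd : ∀ t : ℤ, t * c = 0 → t * d = 0 → t = 0 := fun t hc hd => by
    linear_combination x * hc + y * hd - t * hxy
  have hgm1 : (0 : ℝ) < g - 1 := by linarith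
  -- The neighbour `q - (c, d)` lies on the line of sight from `q` to `p + (c, d)`, so it must be an
  -- endpoint, which forces `g = 2`.
  have hs := hq _ ⟨hm, mem_latticePoints _ _⟩ (by
    intro he
    have e1 : p₁ + c = p₁ := Int.cast_injective (α := ℝ) (congrArg Prod.fst he)
    have e2 : p₂ + d = p₂ := Int.cast_injective (α := ℝ) (congrArg Prod.snd he)
    have := hcd 1 (by linarith) (by linarith)
    omega) (((q₁ - c : ℤ) : ℝ), ((q₂ - d : ℤ) : ℝ))
    ⟨1 - 1 / (g - 1), 1 / (g - 1), by
      rw [sub_nonneg, div_le_one hgm1]; linarith, by positivity, by ring, by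
      ext
      · simp [h1R]; field_simp; ring
      · simp [h2R]; field_simp; ring⟩ (mem_latticePoints _ _)
  have hg_eq : (g : ℤ) = 2 := by
    rcases hs with he | he
    · have e1 : q₁ - c = q₁ := Int.cast_injective (α := ℝ) (congrArg Prod.fst he)
      have e2 : q₂ - d = q₂ := Int.cast_injective (α := ℝ) (congrArg Prod.snd he)
      have := hcd 1 (by linarith) (by linarith)
      omega
    · have e1 : q₁ - c = p₁ + c := Int.cast_injective (α := ℝ) (congrArg Prod.fst he)
      have e2 : q₂ - d = p₂ + d := Int.cast_injective (α := ℝ) (congrArg Prod.snd he)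
      have := hcd (g - 2) (by linarith) (by linarith)
      omega
  rw [hg_eq] at h1 h2
  refine ⟨p₁ + c, p₂ + d, c, d, x, y, hxy, ?_, ?_⟩
  · ext
    · simp [frame]
    · simp [frame]
  · ext
    · simp only [frame]; push_cast
      have : q₁ = p₁ + c * 2 := by linarith
      rw [this]; push_cast; ring
    · simp only [frame]; push_cast
      have : q₂ = p₂ + d * 2 := by linarith
      rw [this]; push_cast; ring

section Frame

variable {m₁ m₂ c d x y : ℤ}

theorem frame_mem_latticePoints (i j : ℤ) : frame m₁ m₂ c d x y i j ∈ latticePoints :=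
  mem_latticePoints _ _

theorem frame_inj (hxy : x * c + y * d = 1) {i j k l : ℤ}
    (h : frame m₁ m₂ c d x y i j = frame m₁ m₂ c d x y k l) : i = k ∧ j = l := by
  have e1 : m₁ + i * c - j * y = m₁ + k * c - l * y := Int.cast_injective (α := ℝ) (congrArg Prod.fst h)
  have e2 : m₂ + i * d + j * x = m₂ + k * d + l * x := Int.cast_injective (α := ℝ) (congrArg Prod.snd h)
  constructor
  · linear_combination x * e1 + y * e2 - (i - k) * hxy
  · linear_combination c * e2 - d * e1 - (j - l) * hxy

theorem exists_frame_eq (m₁ m₂ : ℤ) (hxy : x * c + y * d = 1) (a b : ℤ) :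
    ((a : ℝ), (b : ℝ)) = frame m₁ m₂ c d x y (x * (a - m₁) + y * (b - m₂))
      (c * (b - m₂) - d * (a - m₁)) := by
  ext
  · simp only [frame]
    rw [Int.cast_inj]
    linear_combination (-(a - m₁)) * hxy
  · simp only [frame]
    rw [Int.cast_inj]
    linear_combination (-(b - m₂)) * hxy

theorem frame_visible (hxy : x * c + y * d = 1) {i j k l : ℤ} (h : IsCoprime (k - i) (l - j)) :
    LatticeVisible (frame m₁ m₂ c d x y i j) (frame m₁ m₂ c d x y k l) := by
  obtain ⟨s, t, hst⟩ := h
  refine latticeVisible_of_isCoprime ⟨s * x - t * d, s * y + t * c, ?_⟩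
  linear_combination hst + (s * (k - i) + t * (l - j)) * hxy

/-- A lattice point on the axis beyond the middle is hidden from the opposite end. -/
theorem not_visible_axis (hxy : x * c + y * d = 1) {ε i : ℤ} (hε : ε = 1 ∨ ε = -1)
    (hi : 1 < ε * i) :
    ¬ LatticeVisible (frame m₁ m₂ c d x y (-ε) 0) (frame m₁ m₂ c d x y i 0) := by
  intro h
  have hi1 : (1 : ℝ) < ε * i := by exact_mod_cast hi
  have hi0 : (0 : ℝ) < ε * i + 1 := by linarith
  have hεR : (ε : ℝ) * ε = 1 := by rcases hε with rfl | rfl <;> norm_num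
  have hseg : frame m₁ m₂ c d x y 0 0 ∈
      segment ℝ (frame m₁ m₂ c d x y (-ε) 0) (frame m₁ m₂ c d x y i 0) := by
    refine ⟨(ε * i) / (ε * i + 1), 1 / (ε * i + 1), div_nonneg (by linarith) hi0.le,
      by positivity, by field_simp, ?_⟩
    ext
    · simp [frame]; field_simp
      linear_combination (-(i : ℝ) * c) * hεR
    · simp [frame]; field_simp
      linear_combination (-(i : ℝ) * d) * hεR
  rcases h _ hseg (frame_mem_latticePoints _ _) with h | h
  · have := (frame_inj hxy h).1
    omega
  · have := (frame_inj hxy h).1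
    subst this
    simp at hi

/-- The sight lines from `(-1, 0)` to `(a, δ)` and from `(1, 0)` to `(b, δ)` cross if `b < a`. -/
theorem sightLines_cross (hxy : x * c + y * d = 1) {a b δ : ℤ} (hab : b < a)
    (hδ : δ = 1 ∨ δ = -1) :
    ¬ Disjoint (openSegment ℝ (frame m₁ m₂ c d x y (-1) 0) (frame m₁ m₂ c d x y a δ))
        (openSegment ℝ (frame m₁ m₂ c d x y 1 0) (frame m₁ m₂ c d x y b δ)) ∧
      openSegment ℝ (frame m₁ m₂ c d x y (-1) 0) (frame m₁ m₂ c d x y a δ) ≠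
        openSegment ℝ (frame m₁ m₂ c d x y 1 0) (frame m₁ m₂ c d x y b δ) := by
  have habR : (0 : ℝ) < a - b := by
    have : (b : ℝ) < a := by exact_mod_cast hab
    linarith
  have hxyR : (x : ℝ) * c + y * d = 1 := by exact_mod_cast hxy
  have hδR : (δ : ℝ) * δ = 1 := by rcases hδ with rfl | rfl <;> norm_num
  constructor
  · rw [Set.not_disjoint_iff]
    have hpos : (0 : ℝ) < a - b + 2 := by linarith
    refine ⟨_, ⟨(a - b) / (a - b + 2), 2 / (a - b + 2), by positivity, by positivity,
      by field_simp, rfl⟩, ⟨(a - b) / (a - b + 2), 2 / (a - b + 2), by positivity, by positivity,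
      by field_simp, ?_⟩⟩
    ext
    · simp [frame]; field_simp; ring
    · simp [frame]; field_simp; ring
  -- Pairwise disjointness only concerns distinct sets, so coincidence is excluded too: it would
  -- make every parameter in `(0, 1)` the crossing parameter `2 / (a - b + 2)`.
  · intro heq
    have key : ∀ t : ℝ, 0 < t → t < 1 → t * (a - b + 2) = 2 := by
      intro t ht0 ht1
      have hmem : (1 - t) • frame m₁ m₂ c d x y (-1) 0 + t • frame m₁ m₂ c d x y a δ ∈
          openSegment ℝ (frame m₁ m₂ c d x y 1 0) (frame m₁ m₂ c d x y b δ) :=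
        heq ▸ ⟨1 - t, t, by linarith, ht0, by ring, rfl⟩
      obtain ⟨s, r, -, -, hsr, he⟩ := hmem
      obtain rfl : s = 1 - r := by linarith
      have e1 := congrArg Prod.fst he
      have e2 := congrArg Prod.snd he
      simp [frame] at e1 e2
      have hr : r = t := by
        linear_combination (δ : ℝ) * (c * e2 - d * e1) - (δ : ℝ) * δ * (r - t) * hxyR -
          (r - t) * hδR
      subst hr
      linear_combination -(x * e1 + y * e2) + (2 - r * (a - b + 2)) * hxyR
    have h1 := key (1 / 2) (by norm_num) (by norm_num)
    have h2 := key (1 / 4) (by norm_num) (by norm_num)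
    linarith

end Frame

/-! ### From diploptigon pairs to configurations -/

/-- A diploptigon pair in the interior polygon gives a configuration in integer coordinates. -/
theorem IsDiploptigonPair.sightConfig {Q : Set (ℝ × ℝ)} (hQ : IsLatticePolygon Q)
    {m₁ m₂ c d x y : ℤ} (hxy : x * c + y * d = 1)
    (h : IsDiploptigonPair (interiorPolygon Q) (frame m₁ m₂ c d x y (-1) 0)
      (frame m₁ m₂ c d x y 1 0))
    (hnp : ∀ p ∈ interiorPolygon Q ∩ latticePoints, ∃ r ∈ interiorPolygon Q ∩ latticePoints,
      ¬ LatticeVisible p r) :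
    SightConfig (fun i j => frame m₁ m₂ c d x y i j ∈ interior Q)
      (fun i j => frame m₁ m₂ c d x y i j ∈ Q) := by
  obtain ⟨hp, hq, -, hvp, hvq, hdisj⟩ := h
  have hint := interiorPolygon_subset hQ.convex
  have hsub : ∀ i j, frame m₁ m₂ c d x y i j ∈ interior Q →
      frame m₁ m₂ c d x y i j ∈ interiorPolygon Q ∩ latticePoints := fun i j hij =>
    ⟨interior_inter_subset Q ⟨hij, frame_mem_latticePoints _ _⟩, frame_mem_latticePoints _ _⟩
  refine ⟨hint hp.1, ?_, hint hq.1, ?_, ?_, fun _ _ hij => interior_subset hij, ?_, ?_, ?_, ?_⟩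
  · refine hQ.convex.interior.segment_subset (hint hp.1) (hint hq.1)
      ⟨1 / 2, 1 / 2, by norm_num, by norm_num, by norm_num, ?_⟩
    ext
    · simp [frame]; ring
    · simp [frame]; ring
  · intro i hi
    by_contra! hc
    rcases lt_or_ge i (-1) with h1 | h1
    · exact not_visible_axis hxy (ε := -1) (Or.inr rfl) (by omega)
        (hvq _ (hsub _ _ hi) fun he => by have := (frame_inj hxy he).1; omega)
    · exact not_visible_axis hxy (ε := 1) (Or.inl rfl) (by have := hc h1; omega)
        (hvp _ (hsub _ _ hi) fun he => by have := (frame_inj hxy he).1; have := hc h1; omega)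
  · intro δ a b hδ ha hb
    have key : ∀ a b, frame m₁ m₂ c d x y a δ ∈ interior Q →
        frame m₁ m₂ c d x y b δ ∈ interior Q → a ≤ b := by
      intro a b ha hb
      by_contra! hc
      have hne : ∀ i k, frame m₁ m₂ c d x y i δ ≠ frame m₁ m₂ c d x y k 0 := fun i k he => by
        have := (frame_inj hxy he).2
        omega
      obtain ⟨h1, h2⟩ := sightLines_cross (m₁ := m₁) (m₂ := m₂) hxy hc hδ
      exact h1 (hdisj ⟨_, hsub _ _ ha, hne _ _, hne _ _, Or.inl rfl⟩
        ⟨_, hsub _ _ hb, hne _ _, hne _ _, Or.inr rfl⟩ h2)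
    exact le_antisymm (key _ _ ha hb) (key _ _ hb ha)
  · intro a₁ a₂ b₁ b₂ v₁ v₂ w₁ w₂ α β ha hb hv hα hβ hαβ h1 h2
    have hαR : (0 : ℝ) ≤ α := by exact_mod_cast hα
    have hβR : (0 : ℝ) ≤ β := by exact_mod_cast hβ
    have hαβR : (1 : ℝ) ≤ α + β := by exact_mod_cast hαβ
    have hs : (0 : ℝ) < α + β := by linarith
    have hs1 : (0 : ℝ) < α + β + 1 := by linarith
    have hz := hQ.convex.interior ha hb (div_nonneg hαR hs.le) (div_nonneg hβR hs.le)
      (by field_simp)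
    have hw := hQ.convex.combo_interior_self_mem_interior hz hv (div_pos hs hs1)
      (one_div_pos.2 hs1).le (by field_simp)
    have h1R : ((α : ℝ) + β + 1) * w₁ = α * a₁ + β * b₁ + v₁ := by exact_mod_cast h1
    have h2R : ((α : ℝ) + β + 1) * w₂ = α * a₂ + β * b₂ + v₂ := by exact_mod_cast h2
    convert hw using 1
    ext
    · simp [frame]; field_simp
      linear_combination c * h1R - y * h2R
    · simp [frame]; field_simp
      linear_combination d * h1R + x * h2R
  · intro A B i j hAB hij
    -- The coefficients of `A * i + B * j` rewritten in the standard coordinates.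
    have hAB' : ((A * x - B * d : ℤ) : ℝ) ≠ 0 ∨ ((A * y + B * c : ℤ) : ℝ) ≠ 0 := by
      simp only [Int.cast_ne_zero]
      by_contra! hc
      have hA : A = 0 := by linear_combination c * hc.1 + d * hc.2 - A * hxy
      have hB : B = 0 := by linear_combination x * hc.2 - y * hc.1 - B * hxy
      rcases hAB with h | h <;> contradiction
    obtain ⟨a, b, hab, hlt⟩ := hQ.exists_lt hAB' hij
    refine ⟨_, _, (exists_frame_eq m₁ m₂ hxy a b) ▸ hab, ?_⟩
    simp only [frame] at hlt
    have hlt' : (A * x - B * d) * (m₁ + i * c - j * y) + (A * y + B * c) * (m₂ + i * d + j * x) <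
        (A * x - B * d) * a + (A * y + B * c) * b := by exact_mod_cast hlt
    have : A * i + B * j = (A * x - B * d) * (i * c - j * y) + (A * y + B * c) * (i * d + j * x) := by
      linear_combination (-(A * i + B * j)) * hxy
    rw [this]
    linarith
  · intro i j hij
    obtain ⟨r, ⟨hr, a, b, rfl⟩, hvis⟩ := hnp _ (hsub i j hij)
    rw [exists_frame_eq m₁ m₂ hxy a b] at hr hvis
    refine ⟨_, _, hint hr, ?_, fun hco => hvis (frame_visible hxy hco)⟩
    by_contra! hc
    rw [hc.1, hc.2] at hvis
    refine hvis fun z hz _ => Or.inl ?_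
    simpa using hz
  · obtain ⟨R, hR⟩ := hQ.isBounded.exists_norm_le
    obtain ⟨N, hN⟩ := exists_nat_ge (|(c : ℝ)| * (R + |(m₂ : ℝ)|) + |(d : ℝ)| * (R + |(m₁ : ℝ)|))
    refine ⟨N, fun i j hij => ?_⟩
    have hb := hR _ (interior_subset hij)
    set z := frame m₁ m₂ c d x y i j with hz
    have h1 : |z.1| ≤ R := (norm_fst_le z).trans hb
    have h2 : |z.2| ≤ R := (norm_snd_le z).trans hb
    have hxyR : (x : ℝ) * c + y * d = 1 := by exact_mod_cast hxy
    have hj : (j : ℝ) = c * (z.2 - m₂) - d * (z.1 - m₁) := by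
      simp only [hz, frame]
      push_cast
      linear_combination (-(j : ℝ)) * hxyR
    have : |(j : ℝ)| ≤ N := by
      refine le_trans ?_ hN
      rw [hj]
      refine (abs_sub _ _).trans ?_
      rw [abs_mul, abs_mul]
      gcongr
      · exact (abs_sub _ _).trans (by linarith)
      · exact (abs_sub _ _).trans (by linarith)
    exact_mod_cast this

theorem mainTheorem2 (Q : Set (ℝ × ℝ)) (hQ : IsLatticePolygon Q) :
    ¬ IsDiploptigon (interiorPolygon Q) := by
  rintro ⟨hP, hnp, p, q, h⟩
  have hnp' : ∀ p ∈ interiorPolygon Q ∩ latticePoints,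
      ∃ r ∈ interiorPolygon Q ∩ latticePoints, ¬ LatticeVisible p r := by
    intro p hp
    by_contra! hc
    exact hnp ⟨hP, p, hp, hc⟩
  -- Otherwise `p` alone would see every lattice point.
  have hvis : ¬ LatticeVisible p q := by
    intro hpq
    obtain ⟨r, hr, hrv⟩ := hnp' p h.1
    by_cases hrq : r = q
    · exact hrv (hrq ▸ hpq)
    · exact hrv (h.2.2.2.1 r hr hrq)
  obtain ⟨m₁, m₂, c, d, x, y, hxy, rfl, rfl⟩ := h.exists_frame hP.convex hvis
  exact (h.sightConfig hQ hxy hnp').not_exists
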